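/- Let $\mathscr{A},\mathscr{B},\mathscr{C}$ be unital $C^*$-algebras, and let $\mathscr{A}\bigotimes\mathscr{B}$ be their projective $C^*$-tensor product, that is, the completion of the algebraic tensor product $\mathscr{A}\odot\mathscr{B}$ with respect to the largest $C^*$-crossnorm. Let $\Phi:\mathscr{A}\bigotimes\mathscr{B}\to\mathscr{C}$ be a unital completely positive linear map with commutative range (that is, $\Phi(X)\Phi(Y)=\Phi(Y)\Phi(X)$ for all $X,Y$). Write $\mathrm{Var}_\Phi(X)=\Phi(X^*X)-\Phi(X^*)\Phi(X)$, $[X,Y]=XY-YX$ and $|X|=(X^*X)^{1/2}$. Let $A\in\mathscr{A}$ and $B\in\mathscr{B}$ be such that the (automatically commuting) elements $\mathbf{A}=A\otimes I_{\mathscr{B}}$ and $\mathbf{B}=I_{\mathscr{A}}\otimes B$ are self-adjoint, and for $C\in\mathscr{A}$, $D\in\mathscr{B}$ put $\mathbf{C}=C\otimes I_{\mathscr{B}}$ and $\mathbf{D}=I_{\mathscr{A}}\otimes D$. Then the following hold. 1. For all self-adjoint $C\in\mathscr{A}$ and $D\in\mathscr{B}$ and all $\alpha,\beta\in\mathbb{C}$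 with $\|C-\alpha I_{\mathscr{A}}\|\neq 0$ and $\|D-\beta I_{\mathscr{B}}\|\neq 0$, $$\mathrm{Var}_\Phi(A\otimes I_{\mathscr{B}})\,\mathrm{Var}_\Phi(I_{\mathscr{A}}\otimes B)\ \ge\ \frac{1}{16}\,\frac{\left|\Phi([\mathbf{A},\mathbf{C}])\,\Phi([\mathbf{B},\mathbf{D}])\right|^2}{\left(\|C-\alpha I_{\mathscr{A}}\|\,\|D-\beta I_{\mathscr{B}}\|\right)^2}.$$ 2. For all positive contractions $C\in\mathscr{A}$ and $D\in\mathscr{B}$, $$\mathrm{Var}_\Phi(A\otimes I_{\mathscr{B}})\,\mathrm{Var}_\Phi(I_{\mathscr{A}}\otimes B)\ \ge\ \left|\Phi([\mathbf{A},\mathbf{C}])\right|^2\left|\Phi([\mathbf{B},\mathbf{D}])\right|^2.$$ -/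

import Mathlib

open scoped TensorProduct CStarAlgebra

/-! ### The projective (maximal) `C*`-tensor product of two unital `C*`-algebras -/

section AlgebraicTensor

variable (A B : Type*) [CStarAlgebra A] [CStarAlgebra B]

/-- The algebraic tensor product `A ⊙ B` as a `*`-algebra: a type synonym of `A ⊗[ℂ] B` that
will carry the largest `C*`-crossnorm. -/
def AlgTensor : Type _ := A ⊗[ℂ] B

noncomputable instance : Ring (AlgTensor A B) := inferInstanceAs (Ring (A ⊗[ℂ] B))
noncomputable instance : Algebra ℂ (AlgTensor A B) := inferInstanceAs (Algebra ℂ (A ⊗[ℂ] B))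
noncomputable instance : StarRing (AlgTensor A B) := inferInstanceAs (StarRing (A ⊗[ℂ] B))
instance : StarModule ℂ (AlgTensor A B) := inferInstanceAs (StarModule ℂ (A ⊗[ℂ] B))

variable {A B}

/-- The elementary tensor `a ⊗ b` in the algebraic tensor product. -/
noncomputable def AlgTensor.tmul (a : A) (b : B) : AlgTensor A B := a ⊗ₜ[ℂ] b

theorem AlgTensor.induction {P : AlgTensor A B → Prop} (x : AlgTensor A B) (zero : P 0)
    (tmul : ∀ a b, P (AlgTensor.tmul a b)) (add : ∀ x y, P x → P y → P (x + y)) : P x :=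
  TensorProduct.induction_on x zero tmul add

/-- A seminorm on `A ⊙ B` is a *subcross `C*`-seminorm* if it is submultiplicative, satisfies the
`C*`-identity, and `p (a ⊗ b) ≤ ‖a‖ ‖b‖`. -/
structure IsSubcrossCStarSeminorm (p : Seminorm ℂ (AlgTensor A B)) : Prop where
  mul_le : ∀ x y, p (x * y) ≤ p x * p y
  star_mul_self : ∀ x, p (star x * x) = p x ^ 2
  tmul_le : ∀ a b, p (AlgTensor.tmul a b) ≤ ‖a‖ * ‖b‖

/-- The largest `C*`-crossnorm on `A ⊙ B`, as the pointwise supremum of all subcross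
`C*`-seminorms. (The pointwise maximum of a `C*`-crossnorm and a subcross `C*`-seminorm is again a
`C*`-crossnorm, so this supremum is the largest `C*`-crossnorm.) -/
noncomputable def maxNorm (x : AlgTensor A B) : ℝ :=
  ⨆ p : {p : Seminorm ℂ (AlgTensor A B) // IsSubcrossCStarSeminorm p}, p.1 x

theorem maxNorm_bddAbove (x : AlgTensor A B) :
    BddAbove (Set.range fun p : {p : Seminorm ℂ (AlgTensor A B) // IsSubcrossCStarSeminorm p} =>
      p.1 x) := by
  suffices h : ∃ M, ∀ p : {p : Seminorm ℂ (AlgTensor A B) // IsSubcrossCStarSeminorm p},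
      p.1 x ≤ M by
    obtain ⟨M, hM⟩ := h
    exact ⟨M, by rintro _ ⟨p, rfl⟩; exact hM p⟩
  induction x using AlgTensor.induction with
  | zero => exact ⟨0, fun p => (map_zero p.1).le⟩
  | tmul a b => exact ⟨‖a‖ * ‖b‖, fun p => p.2.tmul_le a b⟩
  | add x y hx hy =>
    obtain ⟨M, hM⟩ := hx
    obtain ⟨N, hN⟩ := hy
    exact ⟨M + N, fun p => (map_add_le_add p.1 x y).trans (add_le_add (hM p) (hN p))⟩

theorem le_maxNorm {p : Seminorm ℂ (AlgTensor A B)} (hp : IsSubcrossCStarSeminorm p)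
    (x : AlgTensor A B) : p x ≤ maxNorm x :=
  le_ciSup (maxNorm_bddAbove x) ⟨p, hp⟩

theorem maxNorm_nonneg (x : AlgTensor A B) : 0 ≤ maxNorm x :=
  Real.iSup_nonneg fun p => apply_nonneg p.1 x

theorem maxNorm_le {x : AlgTensor A B} {M : ℝ} (hM : 0 ≤ M)
    (h : ∀ p : Seminorm ℂ (AlgTensor A B), IsSubcrossCStarSeminorm p → p x ≤ M) :
    maxNorm x ≤ M :=
  Real.iSup_le (fun p => h p.1 p.2) hM

theorem maxNorm_tmul_le (a : A) (b : B) : maxNorm (AlgTensor.tmul a b) ≤ ‖a‖ * ‖b‖ :=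
  maxNorm_le (by positivity) fun _ hp => hp.tmul_le a b

theorem maxNorm_add_le (x y : AlgTensor A B) : maxNorm (x + y) ≤ maxNorm x + maxNorm y :=
  maxNorm_le (add_nonneg (maxNorm_nonneg x) (maxNorm_nonneg y)) fun p hp =>
    (map_add_le_add p x y).trans (add_le_add (le_maxNorm hp x) (le_maxNorm hp y))

theorem maxNorm_smul_le (c : ℂ) (x : AlgTensor A B) : maxNorm (c • x) ≤ ‖c‖ * maxNorm x :=
  maxNorm_le (mul_nonneg (norm_nonneg c) (maxNorm_nonneg x)) fun p hp => by
    rw [map_smul_eq_mul]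
    exact mul_le_mul_of_nonneg_left (le_maxNorm hp x) (norm_nonneg c)

theorem maxNorm_zero : maxNorm (0 : AlgTensor A B) = 0 :=
  le_antisymm (maxNorm_le le_rfl fun p _ => (map_zero p).le) (maxNorm_nonneg 0)

theorem maxNorm_mul_le (x y : AlgTensor A B) : maxNorm (x * y) ≤ maxNorm x * maxNorm y :=
  maxNorm_le (mul_nonneg (maxNorm_nonneg x) (maxNorm_nonneg y)) fun p hp =>
    (hp.mul_le x y).trans
      (mul_le_mul (le_maxNorm hp x) (le_maxNorm hp y) (apply_nonneg p y) (maxNorm_nonneg x))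

theorem maxNorm_sq_le (x : AlgTensor A B) : maxNorm x * maxNorm x ≤ maxNorm (star x * x) := by
  have h : maxNorm x ≤ √(maxNorm (star x * x)) :=
    maxNorm_le (Real.sqrt_nonneg _) fun p hp =>
      Real.le_sqrt_of_sq_le ((hp.star_mul_self x).symm.le.trans (le_maxNorm hp _))
  calc maxNorm x * maxNorm x
      ≤ √(maxNorm (star x * x)) * √(maxNorm (star x * x)) :=
        mul_self_le_mul_self (maxNorm_nonneg x) h
    _ = maxNorm (star x * x) := Real.mul_self_sqrt (maxNorm_nonneg _)

theorem maxNorm_star_le (x : AlgTensor A B) : maxNorm (star x) ≤ maxNorm x := by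
  have h := (maxNorm_sq_le (star x)).trans (maxNorm_mul_le (star (star x)) (star x))
  rw [star_star] at h
  rcases (maxNorm_nonneg (star x)).eq_or_lt with h0 | h0
  · rw [← h0]; exact maxNorm_nonneg x
  · exact le_of_mul_le_mul_right h h0

theorem maxNorm_neg (x : AlgTensor A B) : maxNorm (-x) = maxNorm x := by
  simp only [maxNorm, map_neg_eq_map]

noncomputable instance : SeminormedRing (AlgTensor A B) :=
  RingSeminorm.toSeminormedRing
    { toFun := maxNorm
      map_zero' := maxNorm_zero
      add_le' := maxNorm_add_le
      neg' := maxNorm_neg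
      mul_le' := maxNorm_mul_le }

theorem AlgTensor.norm_def (x : AlgTensor A B) : ‖x‖ = maxNorm x := rfl

noncomputable instance : NormedAlgebra ℂ (AlgTensor A B) where
  norm_smul_le := maxNorm_smul_le

instance : NormedStarGroup (AlgTensor A B) where
  norm_star_le := maxNorm_star_le

end AlgebraicTensor

/-- The projective `C*`-tensor product of `A` and `B`: the (Hausdorff) completion of the algebraic
tensor product with respect to the largest `C*`-crossnorm. -/
def MaxTensorProduct (A B : Type*) [CStarAlgebra A] [CStarAlgebra B] : Type _ :=
  UniformSpace.Completion (AlgTensor A B)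

namespace MaxTensorProduct

variable {A B : Type*} [CStarAlgebra A] [CStarAlgebra B]

noncomputable instance : NormedRing (MaxTensorProduct A B) :=
  inferInstanceAs (NormedRing (UniformSpace.Completion (AlgTensor A B)))

instance : CompleteSpace (MaxTensorProduct A B) :=
  inferInstanceAs (CompleteSpace (UniformSpace.Completion (AlgTensor A B)))

noncomputable instance : Algebra ℂ (MaxTensorProduct A B) :=
  inferInstanceAs (Algebra ℂ (UniformSpace.Completion (AlgTensor A B)))

noncomputable instance : NormedAlgebra ℂ (MaxTensorProduct A B) where
  norm_smul_le := norm_smul_le (α := ℂ) (β := UniformSpace.Completion (AlgTensor A B))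

/-- The canonical map of the algebraic tensor product into its completion. -/
noncomputable def of (x : AlgTensor A B) : MaxTensorProduct A B :=
  UniformSpace.Completion.coe' x

theorem of_add (x y : AlgTensor A B) : of (x + y) = of x + of y :=
  UniformSpace.Completion.coe_add x y

theorem of_mul (x y : AlgTensor A B) : of (x * y) = of x * of y :=
  UniformSpace.Completion.coe_mul x y

theorem of_one : of (1 : AlgTensor A B) = 1 := rfl

theorem of_smul (c : ℂ) (x : AlgTensor A B) : of (c • x) = c • of x :=
  UniformSpace.Completion.coe_smul c x

theorem norm_of (x : AlgTensor A B) : ‖of x‖ = ‖x‖ :=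
  UniformSpace.Completion.norm_coe x

theorem denseRange_of : DenseRange (of : AlgTensor A B → MaxTensorProduct A B) :=
  UniformSpace.Completion.denseRange_coe

theorem continuous_of : Continuous (of : AlgTensor A B → MaxTensorProduct A B) :=
  UniformSpace.Completion.continuous_coe _

/-- The involution of the completion is the continuous extension of the involution. -/
noncomputable instance : Star (MaxTensorProduct A B) where
  star := UniformSpace.Completion.map (star : AlgTensor A B → AlgTensor A B)

theorem continuous_star' : Continuous (star : MaxTensorProduct A B → MaxTensorProduct A B) :=
  UniformSpace.Completion.continuous_map

theorem of_star (x : AlgTensor A B) : of (star x) = star (of x) :=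
  (UniformSpace.Completion.map_coe
    (starNormedAddGroupHom (E := AlgTensor A B)).uniformContinuous x).symm

noncomputable instance : StarRing (MaxTensorProduct A B) where
  star_involutive x := by
    induction x using denseRange_of.induction_on with
    | hp => exact isClosed_eq (continuous_star'.comp continuous_star') continuous_id
    | ih x => rw [← of_star, ← of_star, star_star]
  star_mul x y := by
    induction x, y using denseRange_of.induction_on₂ with
    | hp =>
      exact isClosed_eq (continuous_star'.comp continuous_mul)
        ((continuous_star'.comp continuous_snd).mul (continuous_star'.comp continuous_fst))
    | h x y => rw [← of_mul, ← of_star, ← of_star, ← of_star, ← of_mul, star_mul]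
  star_add x y := by
    induction x, y using denseRange_of.induction_on₂ with
    | hp =>
      exact isClosed_eq (continuous_star'.comp continuous_add)
        ((continuous_star'.comp continuous_fst).add (continuous_star'.comp continuous_snd))
    | h x y => rw [← of_add, ← of_star, ← of_star, ← of_star, ← of_add, star_add]

instance : StarModule ℂ (MaxTensorProduct A B) where
  star_smul c x := by
    induction x using denseRange_of.induction_on with
    | hp =>
      exact isClosed_eq (continuous_star'.comp (continuous_const_smul c))
        (continuous_star'.const_smul (star c))
    | ih x => rw [← of_smul, ← of_star, ← of_star, ← of_smul, star_smul]

instance : CStarRing (MaxTensorProduct A B) where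
  norm_mul_self_le x := by
    induction x using denseRange_of.induction_on with
    | hp =>
      exact isClosed_le (continuous_norm.mul continuous_norm)
        (continuous_norm.comp (continuous_star'.mul continuous_id))
    | ih x =>
      rw [← of_star, ← of_mul, norm_of, norm_of]
      exact maxNorm_sq_le x

noncomputable instance : CStarAlgebra (MaxTensorProduct A B) where

/-- The usual order of a `C*`-algebra: `x ≤ y` iff `y - x` is self-adjoint with spectrum in
`[0, ∞)`. -/
noncomputable instance : PartialOrder (MaxTensorProduct A B) :=
  CStarAlgebra.spectralOrder (MaxTensorProduct A B)

instance : StarOrderedRing (MaxTensorProduct A B) :=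
  CStarAlgebra.spectralOrderedRing (MaxTensorProduct A B)

/-- The elementary tensor `a ⊗ b` in the projective `C*`-tensor product. -/
noncomputable def tmul (a : A) (b : B) : MaxTensorProduct A B := of (AlgTensor.tmul a b)

end MaxTensorProduct

/-- Elementary tensors in the projective `C*`-tensor product. -/
infixl:100 " ⊗ₘ " => MaxTensorProduct.tmul

/-! ### Covariance and variance with respect to a map between `C*`-algebras -/

section Variance

variable {𝒜 ℬ : Type*} [CStarAlgebra 𝒜] [CStarAlgebra ℬ]

/-- `Cov_Φ(X, Y) = Φ(X* Y) - Φ(X*) Φ(Y)`. -/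
def mapCov (Φ : 𝒜 → ℬ) (X Y : 𝒜) : ℬ := Φ (star X * Y) - Φ (star X) * Φ Y

/-- `Var_Φ(X) = Cov_Φ(X, X)`. -/
def mapVar (Φ : 𝒜 → ℬ) (X : 𝒜) : ℬ := mapCov Φ X X

end Variance

/-! The range of `Φ` generates a commutative C*-algebra, where a self-adjoint element is nonnegative
as soon as every character is nonnegative on it. A character composed with `Φ` is a state `f`, and
it turns the operator inequality into a product of two scalar ones, each a Robertson bound `|f [a,
c]|² ≤ 4 Var_f(a) ‖c‖²` (`norm_apply_lie_sq_le`). The two factors 4 give the 16. Shifting `c` by a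
scalar does not change the commutator, so `‖c‖` may be replaced by `‖c - α‖`. For a positive
contraction, `α = 1/2` makes this at most `1/2`, which cancels the 16. -/

/-! ### Variance and commutator bounds for states -/

open scoped ComplexOrder InnerProductSpace in
theorem PositiveLinearMap.norm_apply_star_mul_sq_le {M : Type*} [CStarAlgebra M] [PartialOrder M]
    [StarOrderedRing M] (f : M →ₚ[ℂ] ℂ) (x y : M) :
    ‖f (star x * y)‖ ^ 2 ≤ (f (star x * x)).re * (f (star y * y)).re := by
  have h := norm_inner_le_norm (𝕜 := ℂ) (f.toPreGNS x) (f.toPreGNS y)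
  have hx : ‖f.toPreGNS x‖ ^ 2 = (f (star x * x)).re := by
    have := congrArg Complex.re (f.preGNS_norm_sq (f.toPreGNS x))
    rw [← Complex.ofReal_pow, Complex.ofReal_re] at this
    simpa using this
  have hy : ‖f.toPreGNS y‖ ^ 2 = (f (star y * y)).re := by
    have := congrArg Complex.re (f.preGNS_norm_sq (f.toPreGNS y))
    rw [← Complex.ofReal_pow, Complex.ofReal_re] at this
    simpa using this
  rw [← hx, ← hy, ← mul_pow]
  exact pow_le_pow_left₀ (norm_nonneg _) h 2

open scoped ComplexOrder in
theorem PositiveLinearMap.re_apply_star_mul_self_le {M : Type*} [CStarAlgebra M] [PartialOrder M]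
    [StarOrderedRing M] (f : M →ₚ[ℂ] ℂ) (hf : f 1 = 1) (c : M) :
    (f (star c * c)).re ≤ ‖c‖ ^ 2 := by
  have h := OrderHomClass.mono f (CStarAlgebra.star_mul_le_algebraMap_norm_sq (a := c))
  rw [Algebra.algebraMap_eq_smul_one, ← Complex.coe_smul, map_smul, hf] at h
  simpa [← Complex.ofReal_pow] using (Complex.le_def.1 h).1

open scoped ComplexOrder in
theorem PositiveLinearMap.isSelfAdjoint_sub_apply_smul_one {M : Type*} [CStarAlgebra M]
    [PartialOrder M] [StarOrderedRing M] (f : M →ₚ[ℂ] ℂ) {a : M} (ha : IsSelfAdjoint a) :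
    IsSelfAdjoint (a - f a • (1 : M)) := by
  have hfa : star (f a) = f a := by rw [← map_star, ha.star_eq]
  rw [IsSelfAdjoint, star_sub, star_smul, hfa, ha.star_eq, star_one]

open scoped ComplexOrder in
theorem PositiveLinearMap.apply_sub_mul_sub {M : Type*} [CStarAlgebra M] [PartialOrder M]
    (f : M →ₚ[ℂ] ℂ) (hf : f 1 = 1) (a : M) :
    f ((a - f a • (1 : M)) * (a - f a • (1 : M))) = f (a * a) - f a * f a := by
  simp only [sub_mul, mul_sub, smul_mul_assoc, mul_smul_comm, one_mul, mul_one, map_sub,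
    map_smul, hf, smul_eq_mul]
  ring

open scoped ComplexOrder in
theorem PositiveLinearMap.re_variance_nonneg {M : Type*} [CStarAlgebra M] [PartialOrder M]
    [StarOrderedRing M] (f : M →ₚ[ℂ] ℂ) (hf : f 1 = 1) {a : M} (ha : IsSelfAdjoint a) :
    0 ≤ (f (a * a) - f a * f a).re := by
  rw [← f.apply_sub_mul_sub hf a]
  nth_rewrite 1 [← (f.isSelfAdjoint_sub_apply_smul_one ha).star_eq]
  exact (Complex.le_def.1 (f.map_nonneg (star_mul_self_nonneg _))).1

open scoped ComplexOrder in
/-- Robertson's uncertainty relation for a state, with the second variance bounded by the norm. -/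
theorem PositiveLinearMap.norm_apply_lie_sq_le {M : Type*} [CStarAlgebra M] [PartialOrder M]
    [StarOrderedRing M] (f : M →ₚ[ℂ] ℂ) (hf : f 1 = 1) {a : M} (ha : IsSelfAdjoint a) (c : M) :
    ‖f ⁅a, c⁆‖ ^ 2 ≤ 4 * (f (a * a) - f a * f a).re * ‖c‖ ^ 2 := by
  -- Centring `a` at its mean keeps the commutator and turns `f (b * b)` into the variance.
  set b := a - f a • (1 : M) with hb_def
  have hb : star b = b := (f.isSelfAdjoint_sub_apply_smul_one ha).star_eq
  have hbb : f (b * b) = f (a * a) - f a * f a := f.apply_sub_mul_sub hf a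
  have hlie : ⁅a, c⁆ = b * c - c * b := by
    simp only [Ring.lie_def, hb_def, sub_mul, mul_sub, smul_mul_assoc, mul_smul_comm, one_mul,
      mul_one]
    abel
  set v := (f (a * a) - f a * f a).re with hv_def
  have hv : 0 ≤ v := f.re_variance_nonneg hf ha
  have h1 : ‖f (b * c)‖ ^ 2 ≤ v * ‖c‖ ^ 2 := by
    have h := f.norm_apply_star_mul_sq_le b c
    rw [hb, hbb] at h
    exact h.trans (mul_le_mul_of_nonneg_left (f.re_apply_star_mul_self_le hf c) hv)
  have h2 : ‖f (c * b)‖ ^ 2 ≤ v * ‖c‖ ^ 2 := by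
    have h := f.norm_apply_star_mul_sq_le (star c) b
    have h' := f.re_apply_star_mul_self_le hf (star c)
    rw [norm_star] at h'
    rw [hb, hbb, star_star, mul_comm] at h
    rw [star_star] at h'
    exact h.trans (mul_le_mul_of_nonneg_left h' hv)
  rw [hlie, map_sub]
  have h3 := norm_sub_le (f (b * c)) (f (c * b))
  -- `(s + t)² ≤ 2 (s² + t²)` together with `h1` and `h2` gives the constant 4.
  nlinarith [norm_nonneg (f (b * c) - f (c * b)), sq_nonneg (‖f (b * c)‖ - ‖f (c * b)‖)]

/-! ### Characters of the commutative algebra generated by the range -/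

/-- Spectral permanence identifies the spectrum of `t` in `R` with that in `S`, and by Gelfand
theory the latter consists of character values. -/
theorem StarSubalgebra.nonneg_of_forall_character {R : Type*} [CStarAlgebra R] [PartialOrder R]
    [StarOrderedRing R] (S : StarSubalgebra ℂ R) (hS : IsClosed (S : Set R))
    (hcomm : ∀ x y : S, x * y = y * x) {t : R} (ht : t ∈ S) (hsa : IsSelfAdjoint t)
    (h : ∀ χ : S →⋆ₐ[ℂ] ℂ, 0 ≤ (χ ⟨t, ht⟩).re) : 0 ≤ t := by
  have := hS
  let _ : CommCStarAlgebra S :=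
    { (inferInstance : CStarAlgebra S) with mul_comm := hcomm }
  rw [StarOrderedRing.nonneg_iff_spectrum_nonneg (R := ℝ) t]
  intro r hr
  rw [← spectrum.algebraMap_mem_iff ℂ, ← StarSubalgebra.spectrum_eq (a := (⟨t, ht⟩ : S)),
    WeakDual.CharacterSpace.mem_spectrum_iff_exists] at hr
  obtain ⟨χ, hχ⟩ := hr
  have := h { (AlgHomClass.toAlgHom χ : S →ₐ[ℂ] ℂ) with map_star' := map_star χ }
  have h2 : (χ ⟨t, ht⟩).re = r := by rw [hχ]; simp
  rw [← h2]
  exact this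

open scoped ComplexOrder in
theorem StarSubalgebra.character_nonneg {R : Type*} [CStarAlgebra R] [PartialOrder R]
    [StarOrderedRing R] (S : StarSubalgebra ℂ R) (hS : IsClosed (S : Set R))
    (χ : S →⋆ₐ[ℂ] ℂ) {t : S} (ht : 0 ≤ (t : R)) : 0 ≤ χ t := by
  have := hS
  have h1 := AlgHom.apply_mem_spectrum χ t
  rw [StarSubalgebra.spectrum_eq] at h1
  exact spectrum_nonneg_of_nonneg ht h1

/-- The closed star subalgebra generated by the range of `Φ`. -/
noncomputable def rangeClosure {M R : Type*} [CStarAlgebra R] (Φ : M → R) : StarSubalgebra ℂ R :=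
  (StarAlgebra.adjoin ℂ (Set.range Φ)).topologicalClosure

theorem mem_rangeClosure {M R : Type*} [CStarAlgebra R] (Φ : M → R) (x : M) :
    Φ x ∈ rangeClosure Φ :=
  StarSubalgebra.le_topologicalClosure _ (StarAlgebra.subset_adjoin ℂ _ ⟨x, rfl⟩)

theorem isClosed_rangeClosure {M R : Type*} [CStarAlgebra R] (Φ : M → R) :
    IsClosed (rangeClosure Φ : Set R) :=
  StarSubalgebra.isClosed_topologicalClosure _

/-- Since `Φ` preserves stars, its range is star-closed, so commutation passes to the generated star
algebra and then to its closure. -/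
theorem rangeClosure_mul_comm {M R : Type*} [CStarAlgebra R] [Star M] {Φ : M → R}
    (hstar : ∀ x, Φ (star x) = star (Φ x)) (hcomm : ∀ x y, Commute (Φ x) (Φ y))
    (x y : rangeClosure Φ) : x * y = y * x := by
  have := StarAlgebra.isMulCommutative_adjoin ℂ (s := Set.range Φ)
    (by rintro _ ⟨a, rfl⟩ _ ⟨b, rfl⟩; exact hcomm a b)
    (by rintro _ ⟨a, rfl⟩ _ ⟨b, rfl⟩; rw [← hstar]; exact hcomm a (star b))
  let _ := StarSubalgebra.commRingTopologicalClosure (StarAlgebra.adjoin ℂ (Set.range Φ))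
    (fun a b => mul_comm' a b)
  exact mul_comm (G := (StarAlgebra.adjoin ℂ (Set.range Φ)).topologicalClosure) x y

namespace CompletelyPositiveMap

variable {M R : Type*} [CStarAlgebra M] [PartialOrder M] [StarOrderedRing M]
  [CStarAlgebra R] [PartialOrder R] [StarOrderedRing R]

theorem apply_star (Φ : M →CP R) (x : M) : Φ (star x) = star (Φ x) :=
  map_star (PositiveLinearMap.mk₀ (Φ : M →ₗ[ℂ] R) fun _ h => map_nonneg Φ h) x

open scoped ComplexOrder in
/-- The positive functional obtained by composing `Φ` with a character. -/
noncomputable def compCharacter (Φ : M →CP R) (χ : rangeClosure Φ →⋆ₐ[ℂ] ℂ) : M →ₚ[ℂ] ℂ :=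
  PositiveLinearMap.mk₀
    (χ.toAlgHom.toLinearMap ∘ₗ (LinearMap.codRestrict (rangeClosure Φ).toSubalgebra.toSubmodule
      (Φ : M →ₗ[ℂ] R) (mem_rangeClosure Φ)))
    fun _ hx => StarSubalgebra.character_nonneg _ (isClosed_rangeClosure Φ) χ (map_nonneg Φ hx)

theorem compCharacter_apply (Φ : M →CP R) (χ : rangeClosure Φ →⋆ₐ[ℂ] ℂ) (x : M) :
    Φ.compCharacter χ x = χ ⟨Φ x, mem_rangeClosure Φ x⟩ := rfl

theorem compCharacter_one (Φ : M →CP R) (hΦ : Φ 1 = 1) (χ : rangeClosure Φ →⋆ₐ[ℂ] ℂ) :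
    Φ.compCharacter χ 1 = 1 := by
  rw [compCharacter_apply, ← map_one χ]
  congr 1
  exact Subtype.ext hΦ

/-- The product of two uncertainty relations for a unital completely positive map with commutative
range. -/
theorem smul_star_mul_self_le_mapVar_mul_mapVar (Φ : M →CP R) (hΦ : Φ 1 = 1)
    (hcomm : ∀ x y, Commute (Φ x) (Φ y)) {a b : M} (ha : IsSelfAdjoint a) (hb : IsSelfAdjoint b)
    {c d : M} {r : ℝ} (hr0 : 0 ≤ r) (hr : r * (16 * (‖c‖ * ‖d‖) ^ 2) ≤ 1) :
    r • (star (Φ ⁅a, c⁆ * Φ ⁅b, d⁆) * (Φ ⁅a, c⁆ * Φ ⁅b, d⁆)) ≤ mapVar Φ a * mapVar Φ b := by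
  let S := rangeClosure Φ
  let q (x : M) : S := ⟨Φ x, mem_rangeClosure Φ x⟩
  have hS := rangeClosure_mul_comm Φ.apply_star hcomm
  have hq (x : M) : star (q x) = q (star x) := Subtype.ext (Φ.apply_star x).symm
  let V (x : M) : S := q (x * x) - q x * q x
  have hVsa {x : M} (hx : IsSelfAdjoint x) : star (V x) = V x := by
    simp only [V, star_sub, star_mul, hq, hx.star_eq]
  let P : S := q ⁅a, c⁆ * q ⁅b, d⁆
  let T : S := V a * V b - (r : ℂ) • (star P * P)
  have hT : mapVar Φ a * mapVar Φ b -
      r • (star (Φ ⁅a, c⁆ * Φ ⁅b, d⁆) * (Φ ⁅a, c⁆ * Φ ⁅b, d⁆)) = (T : R) := by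
    simp only [mapVar, mapCov, ha.star_eq, hb.star_eq]
    rw [← Complex.coe_smul]
    rfl
  -- The star reverses `V a * V b`, so commutativity of `S` is needed here.
  have hTsa : star T = T := by
    simp only [T, star_sub, star_mul, star_smul, star_star, hVsa ha, hVsa hb, Complex.star_def,
      Complex.conj_ofReal, hS (V b) (V a)]
  rw [← sub_nonneg, hT]
  refine StarSubalgebra.nonneg_of_forall_character S (isClosed_rangeClosure Φ) hS T.2
    (congrArg Subtype.val hTsa) fun χ => ?_
  let f := Φ.compCharacter χ
  have hf : f 1 = 1 := Φ.compCharacter_one hΦ χ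
  -- `V x` is self-adjoint, so its character value is real; hence the real part of the product below
  -- splits.
  have hreal {x : M} (hx : IsSelfAdjoint x) : χ (V x) = ((f (x * x) - f x * f x).re : ℂ) := by
    have h1 : χ (V x) = f (x * x) - f x * f x := by
      simp only [V, map_sub, map_mul]; rfl
    rw [← h1]
    refine (Complex.conj_eq_iff_re.1 ?_).symm
    rw [← Complex.star_def, ← map_star, hVsa hx]
  have hA := f.norm_apply_lie_sq_le hf ha c
  have hB := f.norm_apply_lie_sq_le hf hb d
  have hP : χ P = f ⁅a, c⁆ * f ⁅b, d⁆ := map_mul χ _ _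
  have hχT : (χ T).re = (f (a * a) - f a * f a).re * (f (b * b) - f b * f b).re -
      r * (‖f ⁅a, c⁆‖ ^ 2 * ‖f ⁅b, d⁆‖ ^ 2) := by
    simp only [T, map_sub, map_mul, map_smul, map_star, hreal ha, hreal hb, hP, smul_eq_mul]
    rw [Complex.star_def, ← Complex.normSq_eq_conj_mul_self, ← mul_pow, ← norm_mul,
      ← Complex.normSq_eq_norm_sq]
    norm_cast
  change 0 ≤ (χ T).re
  rw [hχT, sub_nonneg]
  set v := (f (a * a) - f a * f a).re
  set w := (f (b * b) - f b * f b).re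
  have key : ‖f ⁅a, c⁆‖ ^ 2 * ‖f ⁅b, d⁆‖ ^ 2 ≤ v * w * (16 * (‖c‖ * ‖d‖) ^ 2) := by
    calc _ ≤ (4 * v * ‖c‖ ^ 2) * (4 * w * ‖d‖ ^ 2) :=
          mul_le_mul hA hB (by positivity) ((by positivity : (0 : ℝ) ≤ ‖f ⁅a, c⁆‖ ^ 2).trans hA)
      _ = _ := by ring
  have hvw : 0 ≤ v * w := mul_nonneg (f.re_variance_nonneg hf ha) (f.re_variance_nonneg hf hb)
  calc r * (‖f ⁅a, c⁆‖ ^ 2 * ‖f ⁅b, d⁆‖ ^ 2) ≤ r * (v * w * (16 * (‖c‖ * ‖d‖) ^ 2)) :=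
        mul_le_mul_of_nonneg_left key hr0
    _ = v * w * (r * (16 * (‖c‖ * ‖d‖) ^ 2)) := by ring
    _ ≤ v * w * 1 := mul_le_mul_of_nonneg_left hr hvw
    _ = v * w := mul_one _

end CompletelyPositiveMap

/-! ### Scalar shifts and norms of elementary tensors -/

namespace MaxTensorProduct

variable {A B : Type*} [CStarAlgebra A] [CStarAlgebra B]

theorem tmul_one_sub_smul (C : A) (α : ℂ) :
    (C - α • (1 : A)) ⊗ₘ (1 : B) = C ⊗ₘ (1 : B) - α • 1 := by
  rw [eq_sub_iff_add_eq, ← of_one, ← of_smul, tmul, tmul, ← of_add]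
  congr 1
  change (C - α • (1 : A)) ⊗ₜ[ℂ] (1 : B) + α • ((1 : A) ⊗ₜ[ℂ] (1 : B)) = C ⊗ₜ[ℂ] (1 : B)
  rw [TensorProduct.smul_tmul', ← TensorProduct.add_tmul, sub_add_cancel]

theorem one_tmul_sub_smul (D : B) (β : ℂ) :
    (1 : A) ⊗ₘ (D - β • (1 : B)) = (1 : A) ⊗ₘ D - β • 1 := by
  rw [eq_sub_iff_add_eq, ← of_one, ← of_smul, tmul, tmul, ← of_add]
  congr 1
  change (1 : A) ⊗ₜ[ℂ] (D - β • (1 : B)) + β • ((1 : A) ⊗ₜ[ℂ] (1 : B)) = (1 : A) ⊗ₜ[ℂ] D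
  rw [← TensorProduct.tmul_smul, ← TensorProduct.tmul_add, sub_add_cancel]

theorem norm_tmul_le (a : A) (b : B) : ‖a ⊗ₘ b‖ ≤ ‖a‖ * ‖b‖ :=
  (norm_of _).trans_le (maxNorm_tmul_le a b)

theorem norm_one_le (A : Type*) [CStarAlgebra A] : ‖(1 : A)‖ ≤ 1 := by
  cases subsingleton_or_nontrivial A
  · rw [Subsingleton.elim (1 : A) 0, norm_zero]; exact zero_le_one
  · exact CStarRing.norm_one.le

theorem norm_tmul_one_le (a : A) : ‖a ⊗ₘ (1 : B)‖ ≤ ‖a‖ :=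
  (norm_tmul_le a 1).trans (mul_le_of_le_one_right (norm_nonneg a) (norm_one_le B))

theorem norm_one_tmul_le (b : B) : ‖(1 : A) ⊗ₘ b‖ ≤ ‖b‖ :=
  (norm_tmul_le 1 b).trans (mul_le_of_le_one_left (norm_nonneg b) (norm_one_le A))

end MaxTensorProduct

theorem lie_sub_smul_one {M : Type*} [Ring M] [Algebra ℂ M] (a c : M) (α : ℂ) :
    ⁅a, c - α • (1 : M)⁆ = ⁅a, c⁆ := by
  simp only [Ring.lie_def, mul_sub, sub_mul, mul_smul_comm, smul_mul_assoc, mul_one, one_mul]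
  abel

/-- The spectrum of `c` lies in `[0, 1]`, whose points are within `1/2` of the midpoint. -/
theorem norm_sub_half_smul_one_le {A : Type*} [CStarAlgebra A] [PartialOrder A]
    [StarOrderedRing A] {c : A} (hc : 0 ≤ c) (hc1 : ‖c‖ ≤ 1) :
    ‖c - (1 / 2 : ℂ) • (1 : A)‖ ≤ 1 / 2 := by
  have hsa : IsSelfAdjoint c := .of_nonneg hc
  have h : c - (1 / 2 : ℂ) • (1 : A) = cfc (fun x : ℝ => x - 1 / 2) c := by
    rw [cfc_sub (fun x : ℝ => x) (fun _ => 1 / 2) c, cfc_const (1 / 2 : ℝ) c, cfc_id' ℝ c, Algebra.algebraMap_eq_smul_one,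
      ← Complex.coe_smul]
    norm_num
  rw [h]
  refine norm_cfc_le (by norm_num) fun x hx => ?_
  have h0 : 0 ≤ x := spectrum_nonneg_of_nonneg hc hx
  have h1 : x ≤ 1 := ((le_abs_self x).trans (spectrum.norm_le_norm_mul_of_mem hx)).trans
    (mul_le_one₀ hc1 (norm_nonneg _) (MaxTensorProduct.norm_one_le A))
  rw [Real.norm_eq_abs, abs_le]
  constructor <;> linarith

theorem mainTheorem9 {𝒜 ℬ 𝒞 : Type*}
    [CStarAlgebra 𝒜] [PartialOrder 𝒜] [StarOrderedRing 𝒜]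
    [CStarAlgebra ℬ] [PartialOrder ℬ] [StarOrderedRing ℬ]
    [CStarAlgebra 𝒞] [PartialOrder 𝒞] [StarOrderedRing 𝒞]
    (Φ : MaxTensorProduct 𝒜 ℬ →CP 𝒞) (hΦ_unital : Φ 1 = 1)
    (hΦ_comm : ∀ x y, Commute (Φ x) (Φ y))
    (A : 𝒜) (B : ℬ)
    (hA : IsSelfAdjoint (A ⊗ₘ (1 : ℬ))) (hB : IsSelfAdjoint ((1 : 𝒜) ⊗ₘ B)) :
    (∀ (C : 𝒜) (D : ℬ), IsSelfAdjoint C → IsSelfAdjoint D →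
      ∀ α β : ℂ, ‖C - α • (1 : 𝒜)‖ ≠ 0 → ‖D - β • (1 : ℬ)‖ ≠ 0 →
        ((1 / 16 : ℝ) * ((‖C - α • (1 : 𝒜)‖ * ‖D - β • (1 : ℬ)‖) ^ 2)⁻¹) •
            CFC.abs (Φ ⁅A ⊗ₘ (1 : ℬ), C ⊗ₘ (1 : ℬ)⁆ * Φ ⁅(1 : 𝒜) ⊗ₘ B, (1 : 𝒜) ⊗ₘ D⁆) ^ 2
          ≤ mapVar Φ (A ⊗ₘ (1 : ℬ)) * mapVar Φ ((1 : 𝒜) ⊗ₘ B)) ∧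
    (∀ (C : 𝒜) (D : ℬ), 0 ≤ C → ‖C‖ ≤ 1 → 0 ≤ D → ‖D‖ ≤ 1 →
        CFC.abs (Φ ⁅A ⊗ₘ (1 : ℬ), C ⊗ₘ (1 : ℬ)⁆) ^ 2 *
            CFC.abs (Φ ⁅(1 : 𝒜) ⊗ₘ B, (1 : 𝒜) ⊗ₘ D⁆) ^ 2
          ≤ mapVar Φ (A ⊗ₘ (1 : ℬ)) * mapVar Φ ((1 : 𝒜) ⊗ₘ B)) := by
  -- The free scalar `r` serves both parts: the reciprocal of the norm factor in the first, `1` in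
  -- the second.
  have key (C : 𝒜) (D : ℬ) (α β : ℂ) {r : ℝ} (hr0 : 0 ≤ r)
      (hr : r * (16 * (‖C - α • (1 : 𝒜)‖ * ‖D - β • (1 : ℬ)‖) ^ 2) ≤ 1) :
      r • CFC.abs (Φ ⁅A ⊗ₘ (1 : ℬ), C ⊗ₘ (1 : ℬ)⁆ * Φ ⁅(1 : 𝒜) ⊗ₘ B, (1 : 𝒜) ⊗ₘ D⁆) ^ 2
        ≤ mapVar Φ (A ⊗ₘ (1 : ℬ)) * mapVar Φ ((1 : 𝒜) ⊗ₘ B) := by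
    rw [CFC.abs_sq, ← lie_sub_smul_one (A ⊗ₘ (1 : ℬ)) (C ⊗ₘ (1 : ℬ)) α,
      ← lie_sub_smul_one ((1 : 𝒜) ⊗ₘ B) ((1 : 𝒜) ⊗ₘ D) β,
      ← MaxTensorProduct.tmul_one_sub_smul, ← MaxTensorProduct.one_tmul_sub_smul]
    refine Φ.smul_star_mul_self_le_mapVar_mul_mapVar hΦ_unital hΦ_comm hA hB hr0 (le_trans ?_ hr)
    gcongr
    · exact MaxTensorProduct.norm_tmul_one_le _
    · exact MaxTensorProduct.norm_one_tmul_le _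
  refine ⟨fun C D _ _ α β hC hD => key C D α β (by positivity) (le_of_eq ?_),
    fun C D hC hC1 hD hD1 => ?_⟩
  · field_simp
  -- Both shifted norms are at most `1/2`, and `16 * (1/4)² = 1` allows `r = 1`.
  · have h := key C D (1 / 2) (1 / 2) zero_le_one (by
      have := mul_le_mul (norm_sub_half_smul_one_le hC hC1) (norm_sub_half_smul_one_le hD hD1)
        (norm_nonneg _) (by norm_num)
      have := pow_le_pow_left₀ (by positivity) this 2
      linarith)
    rw [one_smul] at h
    refine le_trans (le_of_eq ?_) h
    -- `|XY|² = |X|²|Y|²`, because `X`, `Y` and their adjoints all lie in the commuting range of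
    -- `Φ`.
    rw [CFC.abs_sq, CFC.abs_sq, CFC.abs_sq, star_mul, ← Φ.apply_star, ← Φ.apply_star]
    simp only [mul_assoc]
    rw [(hΦ_comm (star ⁅(1 : 𝒜) ⊗ₘ B, (1 : 𝒜) ⊗ₘ D⁆) _).left_comm,
      (hΦ_comm (star ⁅(1 : 𝒜) ⊗ₘ B, (1 : 𝒜) ⊗ₘ D⁆) _).left_comm]
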